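/- Let $G$ be a finitely generated group and let $\mu$ be a probability measure on $G$ whose support generates $G$ as a semigroup and which is symmetric, i.e. $\mu(g^{-1})=\mu(g)$ for all $g\in G$. Let $S$ be a finite symmetric generating set of $G$ and let $d$ be the left-invariant word metric of $S$; assume that $d$ is $\mu$-integrable, i.e. $\int_G d(g,e)\,d\mu(g)<\infty$. Then all the integrals $\int_G d(g,e)\,d\mu^{*n}(g)$ are finite, where $\mu^{*n}$ is the $n$-th convolution power of $\mu$, the drift $$\ell_d(\mu)=\lim_{n\to\infty}\frac1n\int_G d(g,e)\,d\mu^{*n}(g)$$ exists and is finite, and $\ell_d(\mu)=0$ if and only if $(G,\mu)$ is Liouville, that is, every bounded function $f:G\to\mathbb{C}$ which is left $\mu$-harmonic, i.e. $f(g)=\int_G f(sg)\,d\check\mu(s)$ for all $g\in G$ with $\check\mu(s)=\mu(s^{-1})$, is constant. -/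

import Mathlib

open Filter Topology
open scoped ENNReal

/-- The word length of `g` with respect to `S`: the least `n` such that `g` is a product of `n`
elements of `S`. (Such an `n` exists for every `g` when `S` is a symmetric generating set.) -/
noncomputable def wordLength {G : Type*} [Group G] (S : Set G) (g : G) : ℕ :=
  sInf {n : ℕ | ∃ l : List G, (∀ x ∈ l, x ∈ S) ∧ l.length = n ∧ l.prod = g}

/-- The left-invariant word metric `d_S(g, h) = |g⁻¹ h|_S`. -/
noncomputable def wordDist {G : Type*} [Group G] (S : Set G) (g h : G) : ℝ :=
  (wordLength S (g⁻¹ * h) : ℝ)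

/-- `S` is a finite symmetric generating set of `G`. -/
structure IsFiniteSymmGenSet {G : Type*} [Group G] (S : Set G) : Prop where
  finite : S.Finite
  symm : ∀ s ∈ S, s⁻¹ ∈ S
  generates : Subgroup.closure S = ⊤

/-- `(G, μ)` is a measured group: the support of the probability measure `μ` generates `G`
as a semigroup. -/
def IsMeasuredGroup {G : Type*} [Group G] (μ : PMF G) : Prop :=
  Subsemigroup.closure μ.support = ⊤

/-- The reflected measure `μ̌(g) = μ(g⁻¹)`. -/
noncomputable def reflected {G : Type*} [Group G] (μ : PMF G) : PMF G :=
  μ.map (fun g => g⁻¹)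

/-- The measure `μ` is symmetric: `μ̌ = μ`. -/
def IsSymmetricMeasure {G : Type*} [Group G] (μ : PMF G) : Prop :=
  reflected μ = μ

/-- The convolution `μ * ν`: the law of `x * y` for independent `x ∼ μ` and `y ∼ ν`. -/
noncomputable def convolution {G : Type*} [Group G] (μ ν : PMF G) : PMF G :=
  μ.bind fun x => ν.map fun y => x * y

/-- The convolution power `μ^{*n}`, where `μ^{*0}` is the point mass at the identity. -/
noncomputable def convPow {G : Type*} [Group G] (μ : PMF G) : ℕ → PMF G
  | 0 => PMF.pure 1
  | n + 1 => convolution (convPow μ n) μ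

/-- The function `g ↦ d(g, e)` is integrable with respect to `μ`. -/
def IsIntegrableMetric {G : Type*} [Group G] (μ : PMF G) (d : G → G → ℝ) : Prop :=
  Summable fun g => (μ g).toReal * d g 1

/-- The integral `∫ d(g, e) dμ(g)`. -/
noncomputable def meanDisplacement {G : Type*} [Group G] (μ : PMF G) (d : G → G → ℝ) : ℝ :=
  ∑' g, (μ g).toReal * d g 1

/-- The sequence `(1 / n) ∫ d(g, e) dμ^{*n}(g)`. -/
noncomputable def meanSpeed {G : Type*} [Group G] (μ : PMF G) (d : G → G → ℝ) (n : ℕ) : ℝ :=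
  (1 / (n : ℝ)) * meanDisplacement (convPow μ n) d

/-- The drift `ℓ_d(μ) = lim_n (1 / n) ∫ d(g, e) dμ^{*n}(g)`. -/
noncomputable def drift {G : Type*} [Group G] (μ : PMF G) (d : G → G → ℝ) : ℝ :=
  limUnder atTop (meanSpeed μ d)

/-- `f` is left `μ`-harmonic: `f(g) = ∫ f(s g) dμ̌(s)` for all `g`, the integral being
absolutely convergent. -/
def IsLeftHarmonic {G : Type*} [Group G] (μ : PMF G) (f : G → ℂ) : Prop :=
  ∀ g : G, HasSum (fun s => ((reflected μ s).toReal : ℂ) * f (s * g)) (f g)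

/-- `(G, μ)` is Liouville: every bounded left `μ`-harmonic function is constant. -/
def IsLiouvilleGroup {G : Type*} [Group G] (μ : PMF G) : Prop :=
  ∀ f : G → ℂ, (∃ C : ℝ, ∀ g, ‖f g‖ ≤ C) → IsLeftHarmonic μ f → ∃ c : ℂ, ∀ g, f g = c

/-! Write |g| for the word length and X_n for a variable of law μ^{*n}. Subadditivity of the mean of
|X_n| (Fekete) gives the drift; the two implications are independent.

Zero drift implies Liouville, through entropy. Spheres grow at most exponentially, so Gibbs'
inequality bounds H(μ^{*n}) by an affine function of the mean of |X_n| (`PMF.entropy_le`), and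
H(μ^{*n})/n tends to 0. Hence some increments H(μ^{*(n+1)}) - H(μ^{*n}) are arbitrarily small. Such
an increment is the μ-average over s of the relative entropy of the right translate of μ^{*n} by s
with respect to μ^{*(n+1)}, so it controls their Hellinger distance
(`mul_tsum_sq_sqrt_sub_sqrt_le`). A bounded harmonic f averages to f(sx) against the first law and
to f(x) against the second, so f(sx) = f(x) for s in the support, which generates G.

Liouville implies zero drift, through a homomorphism. The increments F_x(g) = |gx| - |g| are bounded
by |x|. Limiting Cesàro averages of y ↦ F_x(gy) along the walk are bounded harmonic, hence constant
in y, so the cocycle identity makes the limit T(x) additive in x. The drift is the μ-mean of T by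
telescoping, and it is 0 because T is odd and μ symmetric. -/

/-! ### Word length and exponential growth of spheres. -/

section WordLength

variable {G : Type*} [Group G] {S : Set G}

theorem IsFiniteSymmGenSet.exists_list (hS : IsFiniteSymmGenSet S) (g : G) :
    ∃ l : List G, (∀ x ∈ l, x ∈ S) ∧ l.prod = g := by
  have hg : g ∈ Subgroup.closure S := by rw [hS.generates]; trivial
  induction hg using Subgroup.closure_induction with
  | mem x hx => exact ⟨[x], by simpa using hx, by simp⟩
  | one => exact ⟨[], by simp, rfl⟩
  | mul x y _ _ hx hy =>
    obtain ⟨l, hl, rfl⟩ := hx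
    obtain ⟨m, hm, rfl⟩ := hy
    exact ⟨l ++ m, by simpa [or_imp, forall_and] using ⟨hl, hm⟩, by simp⟩
  | inv x _ hx =>
    obtain ⟨l, hl, rfl⟩ := hx
    refine ⟨(l.map (·⁻¹)).reverse, ?_, (List.prod_inv_reverse l).symm⟩
    intro x hx
    simp only [List.mem_reverse, List.mem_map] at hx
    obtain ⟨y, hy, rfl⟩ := hx
    exact hS.symm y (hl y hy)

theorem IsFiniteSymmGenSet.exists_list_length_eq (hS : IsFiniteSymmGenSet S) (g : G) :
    ∃ l : List G, (∀ x ∈ l, x ∈ S) ∧ l.length = wordLength S g ∧ l.prod = g := by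
  obtain ⟨l, hl, hg⟩ := hS.exists_list g
  exact Nat.sInf_mem
    (s := {n : ℕ | ∃ l : List G, (∀ x ∈ l, x ∈ S) ∧ l.length = n ∧ l.prod = g})
    ⟨l.length, l, hl, rfl, hg⟩

theorem wordLength_le_length {l : List G} (hl : ∀ x ∈ l, x ∈ S) :
    wordLength S l.prod ≤ l.length :=
  Nat.sInf_le ⟨l, hl, rfl, rfl⟩

theorem wordLength_one : wordLength S (1 : G) = 0 :=
  Nat.le_zero.1 (wordLength_le_length (S := S) (l := []) (by simp))

theorem IsFiniteSymmGenSet.wordLength_mul_le (hS : IsFiniteSymmGenSet S) (g h : G) :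
    wordLength S (g * h) ≤ wordLength S g + wordLength S h := by
  obtain ⟨l, hl, hl', rfl⟩ := hS.exists_list_length_eq g
  obtain ⟨m, hm, hm', rfl⟩ := hS.exists_list_length_eq h
  rw [← hl', ← hm', ← List.length_append, ← List.prod_append]
  exact wordLength_le_length (by simpa [or_imp, forall_and] using ⟨hl, hm⟩)

theorem IsFiniteSymmGenSet.wordLength_inv_le (hS : IsFiniteSymmGenSet S) (g : G) :
    wordLength S g⁻¹ ≤ wordLength S g := by
  obtain ⟨l, hl, hl', rfl⟩ := hS.exists_list_length_eq g
  rw [← hl', List.prod_inv_reverse]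
  refine (wordLength_le_length ?_).trans (by simp)
  intro x hx
  simp only [List.mem_reverse, List.mem_map] at hx
  obtain ⟨y, hy, rfl⟩ := hx
  exact hS.symm y (hl y hy)

theorem IsFiniteSymmGenSet.wordLength_inv (hS : IsFiniteSymmGenSet S) (g : G) :
    wordLength S g⁻¹ = wordLength S g :=
  (hS.wordLength_inv_le g).antisymm (by simpa using hS.wordLength_inv_le g⁻¹)

theorem IsFiniteSymmGenSet.wordDist_one (hS : IsFiniteSymmGenSet S) (g : G) :
    wordDist S g 1 = wordLength S g := by
  simp [wordDist, hS.wordLength_inv]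

/-- The sphere of radius `k` has at most `|S| ^ k` elements. -/
theorem IsFiniteSymmGenSet.encard_sphere_le (hS : IsFiniteSymmGenSet S) (k : ℕ) :
    {g : G | wordLength S g = k}.encard ≤ (S.ncard ^ k : ℕ) := by
  have hfin := hS.finite.to_subtype
  have : Fintype S := Fintype.ofFinite S
  let e : List.Vector S k → G := fun v => (v.toList.map Subtype.val).prod
  have hsub : {g : G | wordLength S g = k} ⊆ Set.range e := by
    intro g hg
    obtain ⟨l, hl, hl', rfl⟩ := hS.exists_list_length_eq g
    refine ⟨⟨l.pmap Subtype.mk hl, ?_⟩, ?_⟩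
    · simpa [hl'] using hg
    · change ((l.pmap Subtype.mk hl).map Subtype.val).prod = l.prod
      rw [List.map_pmap, List.pmap_eq_map, List.map_id']
  refine (Set.encard_le_encard hsub).trans ?_
  rw [← Set.image_univ]
  refine (Set.encard_image_le _ _).trans ?_
  rw [Set.encard_univ, ENat.card_eq_coe_fintype_card, card_vector, ← Nat.card_eq_fintype_card,
    Nat.card_coe_set_eq]

/-- These are the weights used in Gibbs' inequality. The sphere of radius k contributes at most
2^{-k}; the `+ 1` keeps the base meaningful when `S` is empty. -/
theorem IsFiniteSymmGenSet.summable_pow_wordLength (hS : IsFiniteSymmGenSet S) :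
    Summable fun g : G => ((2 * (S.ncard + 1) : ℝ)⁻¹) ^ wordLength S g := by
  set a : ENNReal := (2 * (S.ncard + 1))⁻¹ with ha
  have key : ∑' g : G, a ^ wordLength S g ≠ ∞ := by
    have h1 : ∑' g : G, a ^ wordLength S g
        = ∑' k : ℕ, ∑' g : {g : G | wordLength S g = k}, a ^ k := by
      rw [← (Equiv.sigmaFiberEquiv (wordLength S)).tsum_eq, ENNReal.tsum_sigma']
      refine tsum_congr fun k => tsum_congr fun g => ?_
      simp only [Equiv.sigmaFiberEquiv, Equiv.coe_fn_mk]
      rw [g.2]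
    rw [h1]
    have h2 : ∀ k : ℕ, ∑' g : {g : G | wordLength S g = k}, a ^ k ≤ (2⁻¹ : ENNReal) ^ k := by
      intro k
      rw [ENNReal.tsum_const]
      have : (ENat.card {g : G | wordLength S g = k} : ENNReal) ≤ (S.ncard : ENNReal) ^ k := by
        have := hS.encard_sphere_le k
        rw [Set.encard] at this
        calc _ ≤ ((((S.ncard ^ k : ℕ) : ENat)) : ENNReal) := by exact_mod_cast this
          _ = _ := by simp
      calc _ ≤ (S.ncard : ENNReal) ^ k * a ^ k := by gcongr
        _ = (S.ncard * a) ^ k := (mul_pow _ _ _).symm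
        _ ≤ (2⁻¹) ^ k := by
          gcongr
          rw [ha, ENNReal.mul_inv (by simp) (by simp), mul_left_comm]
          refine mul_le_of_le_one_right' ?_
          rw [← div_eq_mul_inv]
          exact ENNReal.div_le_of_le_mul (by simp)
    refine ((ENNReal.tsum_le_tsum h2).trans_lt ?_).ne
    rw [ENNReal.tsum_geometric]
    simp
  refine (ENNReal.summable_toReal key).congr fun g => ?_
  simp [ha, ENNReal.toReal_add]

end WordLength

/-! ### Convolutions and Fubini. -/

section Convolution

variable {G : Type*} [Group G]

theorem PMF.summable_toReal {α : Type*} (p : PMF α) : Summable fun a => (p a).toReal :=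
  ENNReal.summable_toReal p.tsum_coe_ne_top

theorem PMF.hasSum_toReal {α : Type*} (p : PMF α) : HasSum (fun a => (p a).toReal) 1 := by
  convert p.summable_toReal.hasSum
  rw [← ENNReal.tsum_toReal_eq p.apply_ne_top, p.tsum_coe, ENNReal.toReal_one]

theorem convolution_apply (μ ν : PMF G) (g : G) :
    convolution μ ν g = ∑' s, μ (g * s⁻¹) * ν s := by
  classical
  simp only [convolution, PMF.bind_apply, PMF.map_apply]
  calc _ = ∑' x, ∑' y, if g = x * y then μ x * ν y else 0 := by
        refine tsum_congr fun x => ?_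
        rw [← ENNReal.tsum_mul_left]
        exact tsum_congr fun y => by split_ifs <;> simp
    _ = ∑' y, ∑' x, if g = x * y then μ x * ν y else 0 := ENNReal.tsum_comm
    _ = _ := by
        refine tsum_congr fun y => ?_
        rw [tsum_eq_single (g * y⁻¹)]
        · simp
        · intro x hx
          rw [if_neg]
          rintro rfl
          simp at hx

theorem hasSum_convolution (μ ν : PMF G) (g : G) :
    HasSum (fun s => (μ (g * s⁻¹)).toReal * (ν s).toReal) (convolution μ ν g).toReal := by
  have h : ∑' s, μ (g * s⁻¹) * ν s ≠ ∞ := by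
    rw [← convolution_apply]; exact PMF.apply_ne_top _ _
  have h2 := (ENNReal.summable_toReal h).hasSum
  rw [← ENNReal.tsum_toReal_eq (fun s => ENNReal.ne_top_of_tsum_ne_top h s),
    ← convolution_apply] at h2
  simpa using h2

theorem convolution_assoc (μ ν ρ : PMF G) :
    convolution (convolution μ ν) ρ = convolution μ (convolution ν ρ) := by
  simp [convolution, PMF.bind_bind, PMF.map_bind, PMF.bind_map, PMF.map_comp,
    Function.comp_def, mul_assoc]

theorem convolution_one (μ : PMF G) : convolution μ (PMF.pure 1) = μ := by
  simp [convolution, PMF.pure_map]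

theorem convPow_add (μ : PMF G) (m n : ℕ) :
    convPow μ (m + n) = convolution (convPow μ m) (convPow μ n) := by
  induction n with
  | zero => simp [convPow, convolution_one]
  | succ n ih => rw [← add_assoc, convPow, ih, convPow, convolution_assoc]

/-- The bijection `(g, s) ↦ (g * s⁻¹, s)` of `G × G`. -/
def mulInvRightEquiv (G : Type*) [Group G] : G × G ≃ G × G where
  toFun p := (p.1 * p.2⁻¹, p.2)
  invFun p := (p.1 * p.2, p.2)
  left_inv p := by simp
  right_inv p := by simp

/-- Fubini for a convolution: integrating against `μ * ν` by conditioning on the second factor. -/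
theorem hasSum_convolution_smul {E : Type*} [NormedAddCommGroup E] [NormedSpace ℝ E]
    [CompleteSpace E] (μ ν : PMF G) (F : G → E)
    (hF : Summable fun p : G × G => ((μ p.1).toReal * (ν p.2).toReal) • F (p.1 * p.2)) :
    Summable (fun g => (convolution μ ν g).toReal • F g) ∧
    HasSum (fun s => (ν s).toReal • ∑' h, (μ h).toReal • F (h * s))
      (∑' g, (convolution μ ν g).toReal • F g) := by
  have h1 := hF.hasSum
  have h2 : HasSum (fun g => (convolution μ ν g).toReal • F g)
      (∑' p : G × G, ((μ p.1).toReal * (ν p.2).toReal) • F (p.1 * p.2)) := by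
    -- The pair (g s⁻¹, s) has product g, so `F` is constant on the fibre over g.
    have := (mulInvRightEquiv G).hasSum_iff.2 h1
    refine HasSum.prod_fiberwise this fun g => ?_
    simpa [mulInvRightEquiv] using (hasSum_convolution μ ν g).smul_const (F g)
  refine ⟨h2.summable, ?_⟩
  rw [h2.tsum_eq]
  have h3 := (Equiv.prodComm G G).hasSum_iff.2 h1
  have h4 := h3.prod_fiberwise (fun s => (h3.summable.prod_factor s).hasSum)
  convert h4 using 2 with s
  rw [← tsum_const_smul'']
  exact tsum_congr fun h => by simp [smul_smul, mul_comm]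

theorem summable_convolution_of_bounded {E : Type*} [NormedAddCommGroup E] [NormedSpace ℝ E]
    [CompleteSpace E] (μ ν : PMF G) {F : G → E} {C : ℝ} (hF : ∀ g, ‖F g‖ ≤ C) :
    Summable fun p : G × G => ((μ p.1).toReal * (ν p.2).toReal) • F (p.1 * p.2) := by
  have h := (μ.summable_toReal.mul_of_nonneg ν.summable_toReal
    (fun _ => ENNReal.toReal_nonneg) (fun _ => ENNReal.toReal_nonneg)).mul_right C
  refine h.of_norm_bounded fun p => ?_
  rw [norm_smul, Real.norm_of_nonneg (by positivity)]
  gcongr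
  exact hF _

theorem PMF.summable_smul_of_bounded {α E : Type*} [NormedAddCommGroup E] [NormedSpace ℝ E]
    [CompleteSpace E] (μ : PMF α) {F : α → E} {C : ℝ} (hF : ∀ g, ‖F g‖ ≤ C) :
    Summable fun g => (μ g).toReal • F g := by
  refine (μ.summable_toReal.mul_right C).of_norm_bounded fun g => ?_
  rw [norm_smul, Real.norm_of_nonneg (by positivity)]
  gcongr
  exact hF _

theorem PMF.norm_tsum_smul_le {α E : Type*} [NormedAddCommGroup E] [NormedSpace ℝ E]
    [CompleteSpace E] (μ : PMF α) {F : α → E} {C : ℝ} (hF : ∀ g, ‖F g‖ ≤ C) :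
    ‖∑' g, (μ g).toReal • F g‖ ≤ C := by
  refine tsum_of_norm_bounded (g := fun g => (μ g).toReal * C)
    (by simpa using μ.hasSum_toReal.mul_right C) fun g => ?_
  rw [norm_smul, Real.norm_of_nonneg (by positivity)]
  gcongr
  exact hF _

end Convolution

/-! ### Mean displacement and existence of the drift. -/

section Displacement

variable {G : Type*} [Group G] {d : G → G → ℝ}

theorem summable_prod_displacement {μ ν : PMF G} (hd : ∀ g, 0 ≤ d g 1)
    (hmul : ∀ g h, d (g * h) 1 ≤ d g 1 + d h 1)
    (hμ : IsIntegrableMetric μ d) (hν : IsIntegrableMetric ν d) :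
    Summable fun p : G × G => ((μ p.1).toReal * (ν p.2).toReal) • d (p.1 * p.2) 1 := by
  have h1 := hμ.mul_of_nonneg ν.summable_toReal
    (fun g => mul_nonneg ENNReal.toReal_nonneg (hd g)) (fun _ => ENNReal.toReal_nonneg)
  have h2 := μ.summable_toReal.mul_of_nonneg hν (fun _ => ENNReal.toReal_nonneg)
    (fun g => mul_nonneg ENNReal.toReal_nonneg (hd g))
  refine (h1.add h2).of_nonneg_of_le (fun p => ?_) fun p => ?_
  · exact mul_nonneg (by positivity) (hd _)
  · calc _ ≤ ((μ p.1).toReal * (ν p.2).toReal) * (d p.1 1 + d p.2 1) := by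
          rw [smul_eq_mul]; gcongr; exact hmul _ _
      _ = _ := by ring

theorem IsIntegrableMetric.convolution {μ ν : PMF G} (hd : ∀ g, 0 ≤ d g 1)
    (hmul : ∀ g h, d (g * h) 1 ≤ d g 1 + d h 1)
    (hμ : IsIntegrableMetric μ d) (hν : IsIntegrableMetric ν d) :
    IsIntegrableMetric (convolution μ ν) d :=
  (hasSum_convolution_smul μ ν (fun g => d g 1) (summable_prod_displacement hd hmul hμ hν)).1

theorem IsIntegrableMetric.summable_mul_right {μ : PMF G} (hd : ∀ g, 0 ≤ d g 1)
    (hmul : ∀ g h, d (g * h) 1 ≤ d g 1 + d h 1) (hμ : IsIntegrableMetric μ d) (s : G) :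
    Summable fun g => (μ g).toReal * d (g * s) 1 := by
  refine (Summable.add hμ (μ.summable_toReal.mul_right (d s 1))).of_nonneg_of_le
    (fun g => mul_nonneg ENNReal.toReal_nonneg (hd _)) fun g => ?_
  rw [← mul_add]
  gcongr
  exact hmul _ _

theorem meanDisplacement_convolution_le {μ ν : PMF G} (hd : ∀ g, 0 ≤ d g 1)
    (hmul : ∀ g h, d (g * h) 1 ≤ d g 1 + d h 1)
    (hμ : IsIntegrableMetric μ d) (hν : IsIntegrableMetric ν d) :
    meanDisplacement (convolution μ ν) d ≤ meanDisplacement μ d + meanDisplacement ν d := by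
  have h := (hasSum_convolution_smul μ ν (fun g => d g 1)
    (summable_prod_displacement hd hmul hμ hν)).2
  have h2 : HasSum (fun s => (ν s).toReal * (meanDisplacement μ d + d s 1))
      (meanDisplacement μ d + meanDisplacement ν d) := by
    have := (ν.hasSum_toReal.mul_right (meanDisplacement μ d)).add (Summable.hasSum hν)
    simp only [← mul_add, one_mul] at this
    exact this
  refine hasSum_le (fun s => ?_) h h2
  rw [smul_eq_mul]
  gcongr
  refine hasSum_le (fun g => ?_) (hμ.summable_mul_right hd hmul s).hasSum
    ((Summable.hasSum hμ).add (by simpa using μ.hasSum_toReal.mul_right (d s 1)))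
  rw [← mul_add]
  gcongr
  exact hmul _ _

theorem IsIntegrableMetric.convPow {μ : PMF G} (hd : ∀ g, 0 ≤ d g 1)
    (hmul : ∀ g h, d (g * h) 1 ≤ d g 1 + d h 1) (hμ : IsIntegrableMetric μ d) (n : ℕ) :
    IsIntegrableMetric (convPow μ n) d := by
  induction n with
  | zero =>
    refine summable_of_ne_finset_zero (s := {1}) fun g hg => ?_
    simp [_root_.convPow, PMF.pure_apply, show g ≠ 1 by simpa using hg]
  | succ n ih => exact ih.convolution hd hmul hμ

theorem meanDisplacement_nonneg {μ : PMF G} (hd : ∀ g, 0 ≤ d g 1) :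
    0 ≤ meanDisplacement μ d :=
  tsum_nonneg fun g => mul_nonneg ENNReal.toReal_nonneg (hd g)

/-- By subadditivity, the mean speed of a random walk with finite first moment converges. -/
theorem tendsto_meanSpeed_drift {μ : PMF G} (hd : ∀ g, 0 ≤ d g 1)
    (hmul : ∀ g h, d (g * h) 1 ≤ d g 1 + d h 1) (hμ : IsIntegrableMetric μ d) :
    Tendsto (meanSpeed μ d) atTop (𝓝 (drift μ d)) := by
  have hsub : Subadditive fun n => meanDisplacement (convPow μ n) d := fun m n => by
    simp only [convPow_add]
    exact meanDisplacement_convolution_le hd hmul (hμ.convPow hd hmul m) (hμ.convPow hd hmul n)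
  refine tendsto_nhds_limUnder ⟨hsub.lim, ?_⟩
  refine (hsub.tendsto_lim ⟨0, ?_⟩).congr fun n => ?_
  · rintro _ ⟨n, rfl⟩
    exact div_nonneg (meanDisplacement_nonneg hd) n.cast_nonneg
  · rw [meanSpeed, one_div_mul_eq_div]

end Displacement

/-! ### Limits of Cesàro means along an ultrafilter. -/

section UltrafilterLimit

/-- Compactness of [-C, C]. One ultrafilter serves all bounded sequences at once, so no subsequences
need to be extracted. -/
theorem Ultrafilter.tendsto_limUnder_of_abs_le {ι : Type*} (ω : Ultrafilter ι) {a : ι → ℝ} {C : ℝ}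
    (ha : ∀ i, |a i| ≤ C) : Tendsto a ω (𝓝 (limUnder (ω : Filter ι) a)) := by
  obtain ⟨x, -, hx⟩ := (isCompact_Icc (a := -C) (b := C)).ultrafilter_le_nhds (ω.map a)
    (tendsto_principal.2 (Eventually.of_forall fun i => abs_le.1 (ha i)))
  exact tendsto_nhds_limUnder ⟨x, hx⟩

end UltrafilterLimit

section CesaroMean

variable {G : Type*} [Group G]

/-- The Cesàro mean over `n < N` of the averages of `g ↦ F (g * y)` against `μ^{*n}`. -/
noncomputable def cesaroMean (μ : PMF G) (F : G → ℝ) (N : ℕ) (y : G) : ℝ :=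
  (N : ℝ)⁻¹ * ∑ n ∈ Finset.range N, ∑' g, (convPow μ n g).toReal • F (g * y)

theorem abs_cesaroMean_le (μ : PMF G) {F : G → ℝ} {C : ℝ} (hF : ∀ g, |F g| ≤ C) (N : ℕ) (y : G) :
    |cesaroMean μ F N y| ≤ C := by
  have hC : 0 ≤ C := (abs_nonneg _).trans (hF 1)
  have h : |∑ n ∈ Finset.range N, ∑' g, (convPow μ n g).toReal • F (g * y)| ≤ N * C := by
    refine (Finset.abs_sum_le_sum_abs _ _).trans ?_
    refine (Finset.sum_le_card_nsmul _ _ C fun n _ => ?_).trans (by simp)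
    exact (convPow μ n).norm_tsum_smul_le (F := fun g => F (g * y)) fun g => hF _
  rw [cesaroMean, abs_mul, abs_inv, Nat.abs_cast]
  rcases N.eq_zero_or_pos with rfl | hN
  · simpa using hC
  · rw [inv_mul_le_iff₀ (by positivity)]
    exact h

/-- Averaging Cesàro means against `μ` shifts the time by one. -/
theorem tsum_mul_cesaroMean (μ : PMF G) {F : G → ℝ} {C : ℝ} (hF : ∀ g, |F g| ≤ C) (N : ℕ) (y : G) :
    ∑' s, (μ s).toReal * cesaroMean μ F N (s * y) = cesaroMean μ F N y +
      (N : ℝ)⁻¹ * (∑' g, (convPow μ N g).toReal • F (g * y) -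
        ∑' g, (convPow μ 0 g).toReal • F (g * y)) := by
  have h (n : ℕ) : HasSum (fun s => (μ s).toReal * ∑' g, (convPow μ n g).toReal • F (g * (s * y)))
      (∑' g, (convPow μ (n + 1) g).toReal • F (g * y)) := by
    have := (hasSum_convolution_smul (convPow μ n) μ (fun g => F (g * y))
      (summable_convolution_of_bounded _ _ (F := fun g => F (g * y)) (C := C) fun g => hF _)).2
    simp only [mul_assoc] at this
    exact this
  have h2 := (hasSum_sum fun n (_ : n ∈ Finset.range N) => h n).mul_left (N : ℝ)⁻¹
  rw [← Finset.sum_range_sub (fun n => ∑' g, (convPow μ n g).toReal • F (g * y)), cesaroMean,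
    ← mul_add, ← Finset.sum_add_distrib]
  simp only [add_sub_cancel]
  rw [← h2.tsum_eq]
  refine tsum_congr fun s => ?_
  rw [cesaroMean, ← Finset.mul_sum]
  ring

/-- For a Liouville measure, a bounded function has translation invariant limiting Cesàro means. -/
theorem IsLiouvilleGroup.limUnder_cesaroMean_eq {μ : PMF G} (hL : IsLiouvilleGroup μ)
    (hsymm : IsSymmetricMeasure μ) {ω : Ultrafilter ℕ} (hω : (ω : Filter ℕ) ≤ atTop)
    {F : G → ℝ} {C : ℝ} (hF : ∀ g, |F g| ≤ C) (y : G) :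
    limUnder (ω : Filter ℕ) (fun N => cesaroMean μ F N y) =
      limUnder (ω : Filter ℕ) (fun N => cesaroMean μ F N 1) := by
  set f : G → ℝ := fun y => limUnder (ω : Filter ℕ) fun N => cesaroMean μ F N y with hf
  have hlim (y : G) : Tendsto (fun N => cesaroMean μ F N y) ω (𝓝 (f y)) :=
    ω.tendsto_limUnder_of_abs_le fun N => abs_cesaroMean_le μ hF N y
  have hfC (y : G) : |f y| ≤ C :=
    le_of_tendsto (hlim y).abs (Eventually.of_forall fun N => abs_cesaroMean_le μ hF N y)
  -- Dominated convergence moves the limit through the μ-average; the shift in time costs only a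
  -- boundary term of order 1/N.
  have hharm (y : G) : HasSum (fun s => (μ s).toReal * f (s * y)) (f y) := by
    have hs : Summable fun s => (μ s).toReal * f (s * y) :=
      μ.summable_smul_of_bounded (F := fun s => f (s * y)) fun s => hfC _
    convert hs.hasSum
    have h1 : Tendsto (fun N => ∑' s, (μ s).toReal * cesaroMean μ F N (s * y)) ω
        (𝓝 (∑' s, (μ s).toReal * f (s * y))) := by
      refine tendsto_tsum_of_dominated_convergence (bound := fun s => (μ s).toReal * C)
        (μ.summable_toReal.mul_right C) (fun s => (hlim _).const_mul _)
        (Eventually.of_forall fun N s => ?_)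
      rw [norm_mul, Real.norm_of_nonneg ENNReal.toReal_nonneg]
      gcongr
      exact abs_cesaroMean_le μ hF N _
    simp_rw [tsum_mul_cesaroMean μ hF] at h1
    refine tendsto_nhds_unique ?_ h1
    have h2 : Tendsto (fun N : ℕ => (N : ℝ)⁻¹ * (∑' g, (convPow μ N g).toReal • F (g * y) -
        ∑' g, (convPow μ 0 g).toReal • F (g * y))) atTop (𝓝 0) := by
      refine (tendsto_inv_atTop_nhds_zero_nat (𝕜 := ℝ)).zero_mul_isBoundedUnder_le ?_
      refine isBoundedUnder_of ⟨C + C, fun N => ?_⟩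
      exact (norm_sub_le _ _).trans (add_le_add
        ((convPow μ N).norm_tsum_smul_le (F := fun g => F (g * y)) fun g => hF _)
        ((convPow μ 0).norm_tsum_smul_le (F := fun g => F (g * y)) fun g => hF _))
    simpa using (hlim y).add (h2.mono_left hω)
  obtain ⟨c, hc⟩ := hL (fun g => (f g : ℂ)) ⟨C, fun g => by simpa using hfC g⟩ fun g => by
    rw [hsymm]
    simpa using Complex.hasSum_ofReal.2 (hharm g)
  have : (f y : ℂ) = f 1 := (hc y).trans (hc 1).symm
  exact_mod_cast this

/-- For a symmetric Liouville measure with finite first moment, the drift vanishes: it is the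
`μ`-average of a homomorphism to the reals. -/
theorem IsLiouvilleGroup.drift_eq_zero {μ : PMF G} (hL : IsLiouvilleGroup μ)
    (hsymm : IsSymmetricMeasure μ) {d : G → G → ℝ} (hd : ∀ g, 0 ≤ d g 1) (hd1 : d 1 1 = 0)
    (hinv : ∀ g, d g⁻¹ 1 = d g 1)
    (hmul : ∀ g h, d (g * h) 1 ≤ d g 1 + d h 1) (hμ : IsIntegrableMetric μ d) :
    drift μ d = 0 := by
  set ω : Ultrafilter ℕ := hyperfilter ℕ
  have hω : (ω : Filter ℕ) ≤ atTop := Nat.hyperfilter_le_atTop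
  set F : G → G → ℝ := fun x g => d (g * x) 1 - d g 1 with hFdef
  have hF (x g : G) : |F x g| ≤ d x 1 := by
    have h1 := hmul g x
    have h2 := hmul (g * x) x⁻¹
    rw [mul_inv_cancel_right, hinv] at h2
    rw [abs_le]
    constructor <;> simp only [hFdef] <;> linarith
  set T : G → ℝ := fun x => limUnder (ω : Filter ℕ) fun N => cesaroMean μ (F x) N 1 with hT
  have hlim (x : G) : Tendsto (fun N => cesaroMean μ (F x) N 1) ω (𝓝 (T x)) :=
    ω.tendsto_limUnder_of_abs_le fun N => abs_cesaroMean_le μ (hF x) N 1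
  -- Cocycle identity `F (x * y) g = F y (g * x) + F x g`; the Liouville property removes the
  -- translation by x in the first term.
  have hTadd (x y : G) : T (x * y) = T y + T x := by
    have h1 : Tendsto (fun N => cesaroMean μ (F y) N x) ω (𝓝 (T y)) := by
      have := ω.tendsto_limUnder_of_abs_le fun N => abs_cesaroMean_le μ (hF y) N x
      rwa [hL.limUnder_cesaroMean_eq hsymm hω (hF y)] at this
    refine tendsto_nhds_unique (hlim (x * y)) ((h1.add (hlim x)).congr fun N => ?_)
    simp only [cesaroMean]
    rw [← mul_add, ← Finset.sum_add_distrib]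
    congr 1
    refine Finset.sum_congr rfl fun n _ => ?_
    rw [← Summable.tsum_add
      ((convPow μ n).summable_smul_of_bounded (F := fun g => F y (g * x)) fun g => hF _ _)
      ((convPow μ n).summable_smul_of_bounded (F := fun g => F x (g * 1)) fun g => hF _ _)]
    refine tsum_congr fun g => ?_
    simp only [hFdef, smul_eq_mul, mul_one, mul_assoc]
    ring
  have hT1 : T 1 = 0 := by simpa using hTadd 1 1
  have hTinv (x : G) : T x⁻¹ = -T x := by
    have := hTadd x x⁻¹
    rw [mul_inv_cancel, hT1] at this
    linarith
  have hmuinv (s : G) : μ s⁻¹ = μ s := by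
    conv_rhs => rw [← hsymm]
    classical
    rw [reflected, PMF.map_apply, tsum_eq_single s⁻¹]
    · simp
    · intro b hb
      rw [if_neg]
      rintro rfl
      simp at hb
  have hodd : ∑' s, (μ s).toReal * T s = 0 := by
    have h : ∑' s, (μ s).toReal * T s = -∑' s, (μ s).toReal * T s := by
      conv_lhs => rw [← (Equiv.inv G).tsum_eq]
      rw [← tsum_neg]
      exact tsum_congr fun s => by simp [hmuinv, hTinv]
    linarith
  -- The finite first moment supplies the dominating function `d s 1`.
  have h1 : Tendsto (fun N => ∑' s, (μ s).toReal * cesaroMean μ (F s) N 1) ω (𝓝 0) := by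
    rw [← hodd]
    refine tendsto_tsum_of_dominated_convergence (bound := fun s => (μ s).toReal * d s 1)
      hμ (fun s => (hlim _).const_mul _) (Eventually.of_forall fun N s => ?_)
    rw [norm_mul, Real.norm_of_nonneg ENNReal.toReal_nonneg]
    gcongr
    exact abs_cesaroMean_le μ (hF s) N _
  refine tendsto_nhds_unique ((tendsto_meanSpeed_drift hd hmul hμ).mono_left hω)
    (h1.congr fun N => ?_)
  have hint (n : ℕ) := hμ.convPow hd hmul n
  -- Averaging `F s` over s gives the expected one-step increment of displacement, which telescopes
  -- in n.
  have hn (n : ℕ) : HasSum (fun s => (μ s).toReal * ∑' g, (convPow μ n g).toReal • F s (g * 1))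
      (meanDisplacement (convPow μ (n + 1)) d - meanDisplacement (convPow μ n) d) := by
    have h2 := (hasSum_convolution_smul (convPow μ n) μ (fun g => d g 1)
      (summable_prod_displacement hd hmul (hint n) hμ)).2
    have h3 := h2.sub (μ.hasSum_toReal.mul_right (meanDisplacement (convPow μ n) d))
    rw [one_mul] at h3
    refine h3.congr_fun fun s => ?_
    simp only [smul_eq_mul]
    rw [← mul_sub, meanDisplacement, ← Summable.tsum_sub ((hint n).summable_mul_right hd hmul s) (hint n)]
    simp only [hFdef, mul_sub, mul_one]
  have hN := (hasSum_sum fun n (_ : n ∈ Finset.range N) => hn n).mul_left (N : ℝ)⁻¹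
  rw [Finset.sum_range_sub (fun n => meanDisplacement (convPow μ n) d)] at hN
  have h0 : meanDisplacement (convPow μ 0) d = 0 := by
    refine (tsum_congr fun g => ?_).trans tsum_zero
    by_cases hg : g = 1 <;> simp [convPow, PMF.pure_apply, hg, hd1]
  rw [h0, sub_zero] at hN
  rw [meanSpeed, one_div, ← hN.tsum_eq]
  refine tsum_congr fun s => ?_
  rw [cesaroMean, ← Finset.mul_sum]
  ring

end CesaroMean

/-! ### Entropy and Hellinger distance. -/

section Entropy

open Real

/-- Gibbs' inequality for a single term: p times log(q/p) ≤ q/p - 1, with the term -p discarded. -/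
theorem Real.negMulLog_le_neg_mul_log_add {p q : ℝ} (hp : 0 ≤ p) (hq : 0 < q) :
    negMulLog p ≤ -(p * log q) + q := by
  rcases hp.eq_or_lt with rfl | hp
  · simpa using hq.le
  · have h := Real.log_le_sub_one_of_pos (div_pos hq hp)
    rw [Real.log_div hq.ne' hp.ne'] at h
    have h2 := mul_le_mul_of_nonneg_left h hp.le
    have h3 : p * (q / p - 1) = q - p := by field_simp
    rw [negMulLog]
    nlinarith

/-- A pointwise lower bound of relative entropy by the squared Hellinger distance, with a weight
`m` that is allowed to vanish when `r` does. -/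
theorem Real.mul_sq_sqrt_sub_sqrt_le {m p r : ℝ} (hm : 0 ≤ m) (hp : 0 ≤ p) (hr : 0 ≤ r)
    (hmp : m * p ≤ r) :
    m * (√p - √r) ^ 2 ≤ m * r - m * p - m * negMulLog p + m * p * -log r := by
  rcases hm.eq_or_lt with rfl | hm
  · simp
  rcases hp.eq_or_lt with rfl | hp
  · simp [Real.sq_sqrt hr]
  have hr : 0 < r := (mul_pos hm hp).trans_le hmp
  have hsp := Real.sqrt_pos.2 hp
  have hsr := Real.sqrt_pos.2 hr
  -- Bounding the logarithm at √(r/p) instead of r/p is what produces the square.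
  have h := Real.log_le_sub_one_of_pos (div_pos hsr hsp)
  rw [Real.log_div hsr.ne' hsp.ne', Real.log_sqrt hr.le, Real.log_sqrt hp.le] at h
  have h2 := mul_le_mul_of_nonneg_left h hp.le
  have h3 : p * (√r / √p - 1) = √p * √r - p := by
    have : √p * √p = p := Real.mul_self_sqrt hp.le
    field_simp
    linear_combination -√r * this
  have h4 : (√p - √r) ^ 2 = p + r - 2 * (√p * √r) := by
    rw [sub_sq, Real.sq_sqrt hp.le, Real.sq_sqrt hr.le]; ring
  have h5 : (√p - √r) ^ 2 ≤ r - p - negMulLog p + p * -log r := by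
    rw [h4, negMulLog]; linarith
  calc _ ≤ m * (r - p - negMulLog p + p * -log r) := by gcongr
    _ = _ := by ring

/-- Factor p - r through square roots, then use weighted AM-GM and (√p + √r)² ≤ 2(p + r). This
pointwise form of Cauchy–Schwarz can be summed directly. -/
theorem Real.abs_sub_le_sq_sqrt_sub_sqrt {p r t : ℝ} (hp : 0 ≤ p) (hr : 0 ≤ r) (ht : 0 < t) :
    |p - r| ≤ t⁻¹ * (√p - √r) ^ 2 + t * (p + r) := by
  set x := √p
  set y := √r
  have hx : p = x ^ 2 := (Real.sq_sqrt hp).symm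
  have hy : r = y ^ 2 := (Real.sq_sqrt hr).symm
  have hxy : 0 ≤ x + y := add_nonneg (Real.sqrt_nonneg p) (Real.sqrt_nonneg r)
  have h1 : |p - r| = |x - y| * (x + y) := by
    rw [hx, hy, sq_sub_sq, abs_mul, abs_of_nonneg hxy, mul_comm]
  have h2 : t⁻¹ * (x - y) ^ 2 + t * (p + r) = t⁻¹ * ((x - y) ^ 2 + t ^ 2 * (p + r)) := by
    field_simp
  rw [h1, h2, le_inv_mul_iff₀ ht, hx, hy, ← sq_abs (x - y)]
  nlinarith [sq_nonneg (|x - y| - t * (x + y)), mul_nonneg (sq_nonneg t) (sq_nonneg (x - y)),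
    sq_nonneg |x - y|]

/-- The Shannon entropy of a probability mass function. -/
noncomputable def PMF.entropy {α : Type*} (p : PMF α) : ℝ := ∑' a, negMulLog (p a).toReal

theorem PMF.toReal_le_one {α : Type*} (p : PMF α) (a : α) : (p a).toReal ≤ 1 :=
  ENNReal.toReal_le_of_le_ofReal zero_le_one (by simpa using p.coe_le_one a)

theorem PMF.negMulLog_nonneg {α : Type*} (p : PMF α) (a : α) : 0 ≤ negMulLog (p a).toReal :=
  Real.negMulLog_nonneg ENNReal.toReal_nonneg (p.toReal_le_one a)

theorem PMF.entropy_nonneg {α : Type*} (p : PMF α) : 0 ≤ p.entropy :=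
  tsum_nonneg p.negMulLog_nonneg

/-- Gibbs' inequality with an exponential weight. -/
theorem PMF.entropy_le {α : Type*} (p : PMF α) {b : ℝ} (hb : 0 < b) {k : α → ℕ}
    (hk : Summable fun a => b ^ k a) (hp : Summable fun a => (p a).toReal * k a) :
    (Summable fun a => negMulLog (p a).toReal) ∧
      p.entropy ≤ -log b * ∑' a, (p a).toReal * k a + ∑' a, b ^ k a := by
  have hle (a : α) : negMulLog (p a).toReal ≤ -log b * ((p a).toReal * k a) + b ^ k a := by
    refine (Real.negMulLog_le_neg_mul_log_add ENNReal.toReal_nonneg (pow_pos hb (k a))).trans_eq ?_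
    rw [Real.log_pow]; ring
  have hs := (hp.mul_left (-log b)).add hk
  have h := hs.of_nonneg_of_le p.negMulLog_nonneg hle
  refine ⟨h, (h.tsum_le_tsum hle hs).trans_eq ?_⟩
  rw [(hp.mul_left _).tsum_add hk, tsum_mul_left]

theorem PMF.hasSum_prod_mul {α β : Type*} (μ : PMF α) {f : α → β → ℝ} {a : ℝ}
    (h0 : ∀ s g, 0 ≤ f s g) (h : ∀ s, HasSum (f s) a) :
    HasSum (fun x : α × β => (μ x.1).toReal * f x.1 x.2) a := by
  have hfib (s : α) : HasSum (fun g => (μ s).toReal * f s g) ((μ s).toReal * a) :=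
    (h s).mul_left _
  have hnn : 0 ≤ fun x : α × β => (μ x.1).toReal * f x.1 x.2 :=
    fun x => mul_nonneg ENNReal.toReal_nonneg (h0 _ _)
  have hsum : Summable fun x : α × β => (μ x.1).toReal * f x.1 x.2 := by
    rw [summable_prod_of_nonneg hnn]
    refine ⟨fun s => (hfib s).summable, ?_⟩
    simp only [fun s => (hfib s).tsum_eq]
    exact μ.summable_toReal.mul_right a
  have h1 : HasSum (fun s => (μ s).toReal * a) a := by
    have := μ.hasSum_toReal.mul_right a
    rwa [one_mul] at this
  have h2 := hsum.hasSum.prod_fiberwise hfib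
  rw [h1.unique h2]
  exact hsum.hasSum

variable {G : Type*} [Group G]

theorem HasSum.comp_mul_right {E : Type*} [AddCommMonoid E] [TopologicalSpace E] {f : G → E}
    {a : E} (h : HasSum f a) (s : G) : HasSum (fun g => f (g * s)) a :=
  (Equiv.mulRight s).hasSum_iff.2 h

/-- The entropy increment of a convolution dominates the squared Hellinger distance between the
convolution and a right translate of the left factor. -/
theorem mul_tsum_sq_sqrt_sub_sqrt_le (ν μ : PMF G)
    (hν : Summable fun g => negMulLog (ν g).toReal)
    (hc : Summable fun g => negMulLog (convolution ν μ g).toReal) (s : G) (hs : s ∈ μ.support) :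
    (Summable fun g => (√(ν (g * s⁻¹)).toReal - √(convolution ν μ g).toReal) ^ 2) ∧
    (μ s).toReal * ∑' g, (√(ν (g * s⁻¹)).toReal - √(convolution ν μ g).toReal) ^ 2 ≤
      (convolution ν μ).entropy - ν.entropy := by
  set r : G → ℝ := fun g => (convolution ν μ g).toReal with hr
  set m : G → ℝ := fun s => (μ s).toReal with hm
  set p : G → G → ℝ := fun s g => (ν (g * s⁻¹)).toReal with hp
  have hr0 (g) : 0 ≤ r g := ENNReal.toReal_nonneg
  have hm0 (s) : 0 ≤ m s := ENNReal.toReal_nonneg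
  have hp0 (s g) : 0 ≤ p s g := ENNReal.toReal_nonneg
  have hrsum (g) : HasSum (fun s => p s g * m s) (r g) := hasSum_convolution ν μ g
  have hmp (s g) : m s * p s g ≤ r g := by
    rw [mul_comm]
    exact le_hasSum (hrsum g) s fun j _ => mul_nonneg (hp0 _ _) (hm0 _)
  have h1 : HasSum (fun x : G × G => m x.1 * r x.2) 1 :=
    μ.hasSum_prod_mul (f := fun _ g => r g) (fun _ g => hr0 g) fun _ => (convolution ν μ).hasSum_toReal
  have h2 : HasSum (fun x : G × G => m x.1 * p x.1 x.2) 1 :=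
    μ.hasSum_prod_mul (f := p) hp0 fun s => ν.hasSum_toReal.comp_mul_right s⁻¹
  have h3 : HasSum (fun x : G × G => m x.1 * negMulLog (p x.1 x.2)) ν.entropy :=
    μ.hasSum_prod_mul (f := fun s g => negMulLog (p s g)) (fun s g => ν.negMulLog_nonneg _) fun s =>
      hν.hasSum.comp_mul_right s⁻¹
  -- For fixed g, summing over s first turns m s * p s g into r g.
  have h4 : HasSum (fun x : G × G => m x.1 * p x.1 x.2 * -log (r x.2))
      (convolution ν μ).entropy := by
    rw [← (Equiv.prodComm G G).hasSum_iff]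
    have hfib (g : G) : HasSum (fun s => m s * p s g * -log (r g)) (negMulLog (r g)) := by
      simpa [negMulLog, mul_comm] using (hrsum g).mul_right (-log (r g))
    have hnn : 0 ≤ (fun x : G × G => m x.1 * p x.1 x.2 * -log (r x.2)) ∘ Equiv.prodComm G G :=
      fun x => mul_nonneg (mul_nonneg (hm0 _) (hp0 _ _))
        (neg_nonneg.2 (Real.log_nonpos (hr0 _) ((convolution ν μ).toReal_le_one _)))
    have hsum : Summable ((fun x : G × G => m x.1 * p x.1 x.2 * -log (r x.2)) ∘
        Equiv.prodComm G G) := by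
      rw [summable_prod_of_nonneg hnn]
      exact ⟨fun g => (hfib g).summable, hc.congr fun g => (hfib g).tsum_eq.symm⟩
    have h := hsum.hasSum.prod_fiberwise hfib
    rw [PMF.entropy, h.tsum_eq]
    exact hsum.hasSum
  -- The total masses cancel, 1 - 1, leaving the entropy increment.
  have h5 := ((h1.sub h2).sub h3).add h4
  have hle (x : G × G) := Real.mul_sq_sqrt_sub_sqrt_le (hm0 x.1) (hp0 x.1 x.2) (hr0 x.2)
    (hmp x.1 x.2)
  have hnn (x : G × G) : 0 ≤ m x.1 * (√(p x.1 x.2) - √(r x.2)) ^ 2 :=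
    mul_nonneg (hm0 _) (sq_nonneg _)
  have h6 := h5.summable.of_nonneg_of_le hnn hle
  have hms : 0 < m s := ENNReal.toReal_pos hs (μ.apply_ne_top s)
  have h7 := h6.prod_factor s
  refine ⟨(summable_mul_left_iff hms.ne').1 h7, ?_⟩
  rw [← tsum_mul_left]
  calc _ ≤ ∑' s, ∑' g, m s * (√(p s g) - √(r g)) ^ 2 :=
        h6.prod.le_tsum s fun j _ => tsum_nonneg fun g => hnn (j, g)
    _ = ∑' x : G × G, m x.1 * (√(p x.1 x.2) - √(r x.2)) ^ 2 := (h6.tsum_prod).symm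
    _ ≤ _ := (h6.tsum_le_tsum hle h5.summable).trans_eq (by rw [h5.tsum_eq]; ring)

/-! ### Bounded harmonic functions under sublinear entropy. -/

/-- A bounded harmonic function is its own average against every convolution power. -/
theorem hasSum_convPow_of_harmonic {μ : PMF G} {f : G → ℂ} {C : ℝ} (hf : ∀ g, ‖f g‖ ≤ C)
    (hharm : ∀ g, HasSum (fun s => (μ s).toReal • f (s * g)) (f g)) (n : ℕ) (x : G) :
    HasSum (fun g => (convPow μ n g).toReal • f (g * x)) (f x) := by
  induction n generalizing x with
  | zero =>
    classical
    convert hasSum_ite_eq (1 : G) (f x) using 2 with g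
    by_cases hg : g = 1 <;> simp [convPow, PMF.pure_apply, hg]
  | succ n ih =>
    obtain ⟨h1, h2⟩ := hasSum_convolution_smul (convPow μ n) μ (fun g => f (g * x))
      (summable_convolution_of_bounded _ _ (F := fun g => f (g * x)) fun g => hf _)
    have h3 (s : G) : ∑' h, (convPow μ n h).toReal • f (h * s * x) = f (s * x) := by
      simp only [mul_assoc]
      exact (ih (s * x)).tsum_eq
    simp only [h3] at h2
    rw [(hharm x).unique h2]
    exact h1.hasSum

/-- If the entropies of the convolution powers grow sublinearly, then bounded harmonic functions
are invariant under the support of `μ`. -/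
theorem harmonic_apply_mul_eq {μ : PMF G}
    (hsum : ∀ n, Summable fun g => negMulLog (convPow μ n g).toReal)
    (hH : Tendsto (fun n : ℕ => (convPow μ n).entropy / n) atTop (𝓝 0))
    {f : G → ℂ} {C : ℝ} (hf : ∀ g, ‖f g‖ ≤ C)
    (hharm : ∀ g, HasSum (fun s => (μ s).toReal • f (s * g)) (f g))
    {s : G} (hs : s ∈ μ.support) (x : G) : f (s * x) = f x := by
  have hC : 0 ≤ C := (norm_nonneg _).trans (hf 1)
  have hms : 0 < (μ s).toReal := ENNReal.toReal_pos hs (μ.apply_ne_top s)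
  -- If all increments were at least ε, entropy would grow at least linearly.
  have hinc (ε : ℝ) (hε : 0 < ε) :
      ∃ n, (convPow μ (n + 1)).entropy - (convPow μ n).entropy < ε := by
    by_contra! hcon
    have hlow (n : ℕ) : n * ε ≤ (convPow μ n).entropy := by
      induction n with
      | zero => simpa using (convPow μ 0).entropy_nonneg
      | succ n ih => have := hcon n; push_cast; linarith
    have : ε ≤ 0 := by
      refine ge_of_tendsto hH ?_
      filter_upwards [eventually_gt_atTop 0] with n hn
      rw [le_div_iff₀ (by positivity), mul_comm]
      exact hlow n
    linarith
  -- With D ≤ t², the Hellinger part gives t⁻¹ D ≤ t and the two unit masses give 2t.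
  have hbound (t : ℝ) (ht : 0 < t) : ‖f (s * x) - f x‖ ≤ C * (3 * t) := by
    obtain ⟨n, hn⟩ := hinc ((μ s).toReal * t ^ 2) (by positivity)
    set ν := convPow μ n
    obtain ⟨h1, h2⟩ := mul_tsum_sq_sqrt_sub_sqrt_le ν μ (hsum n) (hsum (n + 1)) s hs
    set D := ∑' g, (√(ν (g * s⁻¹)).toReal - √(convolution ν μ g).toReal) ^ 2 with hD
    have hDt : D ≤ t ^ 2 := le_of_mul_le_mul_left (h2.trans hn.le) hms
    have ha : HasSum (fun g => (ν (g * s⁻¹)).toReal • f (g * x)) (f (s * x)) := by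
      simpa [mul_assoc] using (hasSum_convPow_of_harmonic hf hharm n (s * x)).comp_mul_right s⁻¹
    have hb : HasSum (fun g => (convolution ν μ g).toReal • f (g * x)) (f x) :=
      hasSum_convPow_of_harmonic hf hharm (n + 1) x
    have hp1 : HasSum (fun g => (ν (g * s⁻¹)).toReal) 1 :=
      ν.hasSum_toReal.comp_mul_right s⁻¹
    have hdom := ((h1.hasSum.mul_left t⁻¹).add
      ((hp1.add (convolution ν μ).hasSum_toReal).mul_left t)).mul_left C
    rw [← (ha.sub hb).tsum_eq]
    have hle (g : G) : ‖(ν (g * s⁻¹)).toReal • f (g * x) - (convolution ν μ g).toReal • f (g * x)‖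
        ≤ C * (t⁻¹ * (√(ν (g * s⁻¹)).toReal - √(convolution ν μ g).toReal) ^ 2 +
          t * ((ν (g * s⁻¹)).toReal + (convolution ν μ g).toReal)) := by
      rw [← sub_smul, norm_smul, mul_comm C]
      have h := Real.abs_sub_le_sq_sqrt_sub_sqrt (p := (ν (g * s⁻¹)).toReal)
        (r := (convolution ν μ g).toReal) ENNReal.toReal_nonneg ENNReal.toReal_nonneg ht
      rw [← Real.norm_eq_abs] at h
      exact mul_le_mul h (hf _) (norm_nonneg _) ((norm_nonneg _).trans h)
    refine (tsum_of_norm_bounded hdom hle).trans ?_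
    · gcongr
      have : t⁻¹ * D ≤ t := by
        rw [inv_mul_le_iff₀ ht]; nlinarith
      rw [← hD]
      linarith
  have hlim : Tendsto (fun t : ℝ => C * (3 * t)) (𝓝[>] 0) (𝓝 0) := by
    have : Continuous fun t : ℝ => C * (3 * t) := by fun_prop
    simpa using (this.tendsto 0).mono_left nhdsWithin_le_nhds
  have := ge_of_tendsto hlim (eventually_mem_nhdsWithin.mono fun t ht => hbound t ht)
  exact sub_eq_zero.1 (norm_le_zero_iff.1 this)

theorem isLiouvilleGroup_of_entropy {μ : PMF G} (hμ : IsMeasuredGroup μ)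
    (hsymm : IsSymmetricMeasure μ)
    (hsum : ∀ n, Summable fun g => negMulLog (convPow μ n g).toReal)
    (hH : Tendsto (fun n : ℕ => (convPow μ n).entropy / n) atTop (𝓝 0)) :
    IsLiouvilleGroup μ := by
  rintro f ⟨C, hC⟩ hf
  have hharm : ∀ g, HasSum (fun s => (μ s).toReal • f (s * g)) (f g) := fun g => by
    have := hf g
    rw [hsymm] at this
    simpa using this
  refine ⟨f 1, fun g => ?_⟩
  have hg : g ∈ Subsemigroup.closure μ.support := by rw [hμ]; trivial
  suffices ∀ x, f (g * x) = f x by simpa using this 1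
  induction hg using Subsemigroup.closure_induction with
  | mem s hs => exact harmonic_apply_mul_eq hsum hH hC hharm hs
  | mul a b _ _ ha hb => intro x; rw [mul_assoc, ha, hb]

end Entropy

/-! ### From zero drift to zero entropy growth, and the equivalence. -/

/-- For a random walk with finite first moment and vanishing drift, the entropy of the
convolution powers grows sublinearly. -/
theorem IsFiniteSymmGenSet.tendsto_entropy_div {G : Type*} [Group G] {μ : PMF G} {S : Set G}
    (hS : IsFiniteSymmGenSet S) (hint : ∀ n, IsIntegrableMetric (convPow μ n) (wordDist S))
    (h0 : Tendsto (meanSpeed μ (wordDist S)) atTop (𝓝 0)) :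
    (∀ n, Summable fun g => Real.negMulLog (convPow μ n g).toReal) ∧
      Tendsto (fun n : ℕ => (convPow μ n).entropy / n) atTop (𝓝 0) := by
  set b : ℝ := (2 * (S.ncard + 1) : ℝ)⁻¹
  have hgibbs (n : ℕ) := (convPow μ n).entropy_le (b := b) (by positivity)
    hS.summable_pow_wordLength (by simpa only [IsIntegrableMetric, hS.wordDist_one] using hint n)
  refine ⟨fun n => (hgibbs n).1, ?_⟩
  have hup : Tendsto (fun n : ℕ => -Real.log b * meanSpeed μ (wordDist S) n +
      (n : ℝ)⁻¹ * ∑' g : G, b ^ wordLength S g) atTop (𝓝 0) := by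
    simpa using (h0.const_mul (-Real.log b)).add
      ((tendsto_inv_atTop_nhds_zero_nat (𝕜 := ℝ)).mul_const (∑' g : G, b ^ wordLength S g))
  refine squeeze_zero (fun n => div_nonneg (PMF.entropy_nonneg _) n.cast_nonneg) (fun n => ?_) hup
  calc _ ≤ (-Real.log b * ∑' g, (convPow μ n g).toReal * wordLength S g +
        ∑' g, b ^ wordLength S g) / n := by gcongr; exact (hgibbs n).2
    _ = _ := by
        simp only [meanSpeed, meanDisplacement, hS.wordDist_one]
        ring

/-- For a finitely generated symmetric measured group and an integrable word metric `d`, the drift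
is well defined (all integrals in it are finite and the limit exists), and it vanishes if and only
if the measured group is Liouville. -/
theorem theorem1p1 {G : Type*} [Group G] (μ : PMF G) (S : Set G)
    (hS : IsFiniteSymmGenSet S) (hμ : IsMeasuredGroup μ) (hsymm : IsSymmetricMeasure μ)
    (hint : IsIntegrableMetric μ (wordDist S)) :
    (∀ n : ℕ, IsIntegrableMetric (convPow μ n) (wordDist S)) ∧
    Tendsto (meanSpeed μ (wordDist S)) atTop (𝓝 (drift μ (wordDist S))) ∧
    (drift μ (wordDist S) = 0 ↔ IsLiouvilleGroup μ) := by
  have hd (g : G) : 0 ≤ wordDist S g 1 := Nat.cast_nonneg _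
  have hmul (g h : G) : wordDist S (g * h) 1 ≤ wordDist S g 1 + wordDist S h 1 := by
    simp only [hS.wordDist_one]
    exact_mod_cast hS.wordLength_mul_le g h
  have hlim := tendsto_meanSpeed_drift hd hmul hint
  refine ⟨hint.convPow hd hmul, hlim, fun h0 => ?_, fun hL => ?_⟩
  · rw [h0] at hlim
    obtain ⟨h1, h2⟩ := hS.tendsto_entropy_div (hint.convPow hd hmul) hlim
    exact isLiouvilleGroup_of_entropy hμ hsymm h1 h2
  · refine hL.drift_eq_zero hsymm hd ?_ (fun g => ?_) hmul hint
    · simp [hS.wordDist_one, wordLength_one]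
    · simp [hS.wordDist_one, hS.wordLength_inv]
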